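/- Let $\Gamma$ be a finite group and let $\mathcal{F}$ be a family of proper subgroups of $\Gamma$, that is, a non-empty set of proper subgroups of $\Gamma$ that is closed under conjugation and under passing to subgroups. Let $\mathcal{O}_{\mathcal{F}}\Gamma$ be the orbit category, whose objects are the $\Gamma$-sets $\Gamma/H$ with $H\in\mathcal{F}$ and whose morphisms are the $\Gamma$-equivariant maps, and let $\mathsf{cd}_{\mathcal{F}}(\Gamma)\in\mathbb{N}\cup\{\infty\}$ be the projective dimension of the constant functor $\underline{\mathbb{Z}}$ (with value $\mathbb{Z}$ on all objects and the identity on all morphisms) in the abelian category of contravariant functors from $\mathcal{O}_{\mathcal{F}}\Gamma$ to abelian groups. Then $$\mathsf{cd}_{\mathcal{F}}(\Gamma)\geq 2.$$ -/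

import Mathlib

open CategoryTheory

universe u

/-- A family of subgroups of `Γ`: a non-empty set of subgroups which is closed under conjugation
and under passing to subgroups. -/
structure SubgroupFamily (Γ : Type*) [Group Γ] where
  carrier : Set (Subgroup Γ)
  nonempty : carrier.Nonempty
  conj_mem : ∀ H ∈ carrier, ∀ g : Γ, H.map (MulAut.conj g).toMonoidHom ∈ carrier
  mem_of_le : ∀ H ∈ carrier, ∀ K : Subgroup Γ, K ≤ H → K ∈ carrier

/-- The orbit category of `Γ` with respect to the family `F`: the objects are the `Γ`-sets `Γ ⧸ H`
with `H` in `F` (recorded by the subgroup `H`). -/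
structure OrbitCategory {Γ : Type*} [Group Γ] (F : SubgroupFamily Γ) where
  subgroup : Subgroup Γ
  mem : subgroup ∈ F.carrier

namespace OrbitCategory

/-- The morphisms of the orbit category are the `Γ`-equivariant maps `Γ ⧸ H → Γ ⧸ K`. -/
instance {Γ : Type*} [Group Γ] (F : SubgroupFamily Γ) : SmallCategory (OrbitCategory F) where
  Hom X Y := (Γ ⧸ X.subgroup) →[Γ] (Γ ⧸ Y.subgroup)
  id X := MulActionHom.id Γ
  comp f g := g.comp f

end OrbitCategory

/-- For a small category `C`, a `C`-module is a contravariant functor from `C` to abelian groups. -/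
abbrev CatModule (C : Type u) [SmallCategory C] := Cᵒᵖ ⥤ AddCommGrpCat.{u}

/-- The constant `C`-module with value `ℤ` on all objects and the identity on all morphisms
(`ULift` only moves `ℤ` to the universe of `C`). -/
abbrev constIntModule (C : Type u) [SmallCategory C] : CatModule C :=
  (Functor.const Cᵒᵖ).obj (AddCommGrpCat.of (ULift.{u} ℤ))

/-- The cohomological dimension of a small category `C`: the projective dimension of the constant
module `ℤ` in the abelian category of `C`-modules. -/
noncomputable def catCohomologicalDimension (C : Type u) [SmallCategory C] : WithBot ℕ∞ :=
  projectiveDimension (constIntModule C)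

/-- The cohomological dimension of `Γ` with respect to the family `F` of subgroups: the
cohomological dimension of the orbit category. -/
noncomputable def bredonCohomologicalDimension {Γ : Type u} [Group Γ] (F : SubgroupFamily Γ) :
    WithBot ℕ∞ :=
  catCohomologicalDimension (OrbitCategory F)

/-! Suppose the dimension is at most 1. The kernel of the augmentation of the sum of all
representables is then projective, so the surjection onto it from the free module on pairs of arrows
splits. At the object `Γ/1` the splitting becomes an `ArcSection`: an additive, equivariant choice
of chains between points, each chain staying inside the points fixed by everything that fixes both
of its ends (`exists_natural_arcs`, `OrbitCategory.nonempty_arcSection`). Restrict it to a minimal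
subgroup `G` outside the family: every proper subgroup of `G` fixes a point, but `G` fixes none.
`ArcSection.false_of_fixed` refutes this.

A winding number shows that no maximal subgroup of `G` is normal (`not_normal_stabilizer`). The
section can therefore be moved to the set of maximal subgroups under conjugation, where each is its
own stabilizer. Join each maximal subgroup to the nodes (maximal branching subgroups) that it
contains. The section forces this bipartite graph to be a forest (`eq_zero_of_incidence_sums`). If
no node is normal, distinct leaves hang on distinct nodes of degree at least 3, which gives too many
edges for a forest (`exists_normal_node`). If a node `L` is normal, the maximal subgroups above `L`
partition the complement of `L`, and counting conjugates excludes this (`not_normal_node`). -/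

/-! ### Chains on a complete directed graph. -/

section Arcs

variable {X Y : Type*}

/-- The boundary map from integral `1`-chains on the complete directed graph on `X`
to integral `0`-chains. -/
noncomputable def arcBoundary (X : Type*) : (X × X →₀ ℤ) →+ (X →₀ ℤ) :=
  Finsupp.liftAddHom fun p =>
    Finsupp.singleAddHom p.1 - Finsupp.singleAddHom p.2

@[simp]
theorem arcBoundary_single (p : X × X) (n : ℤ) :
    arcBoundary X (Finsupp.single p n) = Finsupp.single p.1 n - Finsupp.single p.2 n := by
  simp [arcBoundary]

theorem arcBoundary_mapDomain (f : X → Y) (c : X × X →₀ ℤ) :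
    arcBoundary Y (Finsupp.mapDomain (Prod.map f f) c) = Finsupp.mapDomain f (arcBoundary X c) := by
  have : (arcBoundary Y).comp (Finsupp.mapDomain.addMonoidHom (Prod.map f f)) =
      (Finsupp.mapDomain.addMonoidHom f).comp (arcBoundary X) := by
    ext p : 2
    simp [Finsupp.mapDomain_single, map_sub]
  exact DFunLike.congr_fun this c

end Arcs

/-! ### Free modules over a category and projective dimension at most 1. -/

namespace CatModule

variable {C : Type u} [SmallCategory C]

/-- The free `C`-module on a presheaf of sets. -/
noncomputable def linearization (P : C → Type u) (r : ∀ {c d : C}, (c ⟶ d) → P d → P c)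
    (hid : ∀ c, r (𝟙 c) = id) (hcomp : ∀ {c d e : C} (f : c ⟶ d) (g : d ⟶ e), r (f ≫ g) = r f ∘ r g) :
    CatModule C where
  obj c := AddCommGrpCat.of (P c.unop →₀ ℤ)
  map f := AddCommGrpCat.ofHom (Finsupp.mapDomain.addMonoidHom (r f.unop))
  map_id c := by
    ext x
    simp [hid]
  map_comp f g := by
    ext x
    simp [hcomp, Finsupp.mapDomain_single]

/-- The arrows of `C` with source `c`. -/
abbrev ArrowsFrom (c : C) : Type u := Σ d : C, (c ⟶ d)

/-- Precomposition of arrows. -/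
def ArrowsFrom.precomp {c d : C} (f : c ⟶ d) (a : ArrowsFrom d) : ArrowsFrom c := ⟨a.1, f ≫ a.2⟩

theorem ArrowsFrom.precomp_id (c : C) : ArrowsFrom.precomp (𝟙 c) = id := by
  funext a; simp [ArrowsFrom.precomp]

theorem ArrowsFrom.precomp_comp {c d e : C} (f : c ⟶ d) (g : d ⟶ e) :
    ArrowsFrom.precomp (f ≫ g) = ArrowsFrom.precomp f ∘ ArrowsFrom.precomp g := by
  funext a; simp [ArrowsFrom.precomp]

variable (C) in
/-- The direct sum of all representable `C`-modules. -/
noncomputable def freeArrows : CatModule C :=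
  linearization ArrowsFrom ArrowsFrom.precomp ArrowsFrom.precomp_id ArrowsFrom.precomp_comp

variable (C) in
/-- The free `C`-module on pairs of arrows with the same source. -/
noncomputable def freeArrowPairs : CatModule C :=
  linearization (fun c => ArrowsFrom c × ArrowsFrom c) (fun f => Prod.map (.precomp f) (.precomp f))
    (by simp [ArrowsFrom.precomp_id]) (by simp [ArrowsFrom.precomp_comp, Prod.map_comp_map])

/-- By Yoneda, a map out is given by arbitrary values on the identity arrows, so only these need
lifting. -/
instance : Projective (freeArrows C) where
  factors {E B} f e he := by
    have hs : ∀ d : C, ∃ t : E.obj (.op d),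
        e.app (.op d) t = f.app (.op d) (Finsupp.single (⟨d, 𝟙 d⟩ : ArrowsFrom d) (1 : ℤ)) := by
      intro d
      have := (NatTrans.epi_iff_epi_app e).1 he (.op d)
      exact (AddCommGrpCat.epi_iff_surjective _).1 this _
    choose t ht using hs
    refine ⟨{ app := fun c => AddCommGrpCat.ofHom (Finsupp.liftAddHom fun a : ArrowsFrom c.unop =>
                (zmultiplesHom _ (E.map a.2.op (t a.1)))), naturality := ?_ }, ?_⟩
    · intro c d g
      refine AddCommGrpCat.hom_ext (Finsupp.addHom_ext' fun a => ?_)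
      ext
      simp [freeArrows, linearization, ArrowsFrom.precomp]
    · ext c : 2
      refine AddCommGrpCat.hom_ext (Finsupp.addHom_ext' fun a => AddMonoidHom.ext_int ?_)
      have h1 : e.app c (E.map a.2.op (t a.1)) = B.map a.2.op (e.app _ (t a.1)) :=
        NatTrans.naturality_apply e a.2.op (t a.1)
      have h2 := NatTrans.naturality_apply f a.2.op
        (Finsupp.single (⟨a.1, 𝟙 a.1⟩ : ArrowsFrom a.1) (1 : ℤ))
      have h3 : (freeArrows C).map a.2.op (Finsupp.single (⟨a.1, 𝟙 a.1⟩ : ArrowsFrom a.1) (1 : ℤ)) =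
          Finsupp.single a (1 : ℤ) := by
        refine (Finsupp.mapDomain_single).trans ?_
        simp [ArrowsFrom.precomp]
      have h4 : (Finsupp.liftAddHom fun a : ArrowsFrom c.unop =>
                (zmultiplesHom _ (E.map a.2.op (t a.1)))) (Finsupp.single a (1 : ℤ)) =
              E.map a.2.op (t a.1) := by simp
      refine (congrArg (e.app c) h4).trans (h1.trans ?_)
      rw [ht]
      exact h2.symm.trans (congrArg (f.app c) h3)

/-- The difference map sending a pair of arrows to the difference of its members. -/
noncomputable def difference : freeArrowPairs C ⟶ freeArrows C where
  app _ := AddCommGrpCat.ofHom (arcBoundary _)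
  naturality _ _ f := AddCommGrpCat.hom_ext <| AddMonoidHom.ext fun x =>
    arcBoundary_mapDomain (ArrowsFrom.precomp f.unop) x

/-- The sum of the coefficients. -/
noncomputable def coefficientSum (X : Type*) : (X →₀ ℤ) →+ ULift.{u} ℤ :=
  Finsupp.liftAddHom fun _ => AddEquiv.ulift.symm.toAddMonoidHom

@[simp]
theorem coefficientSum_single {X : Type*} (x : X) (n : ℤ) :
    coefficientSum.{u} X (Finsupp.single x n) = ULift.up n := by
  simp [coefficientSum]
  rfl

/-- The augmentation of the direct sum of all representable modules. -/
noncomputable def augmentation : freeArrows C ⟶ constIntModule C where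
  app c := AddCommGrpCat.ofHom (coefficientSum _)
  naturality c d f := by
    refine AddCommGrpCat.hom_ext (Finsupp.addHom_ext' fun a => AddMonoidHom.ext_int ?_)
    refine (congrArg (coefficientSum.{u} _) Finsupp.mapDomain_single).trans ?_
    refine (coefficientSum_single _ _).trans (coefficientSum_single a (1 : ℤ)).symm

instance : Epi (augmentation (C := C)) := by
  refine (NatTrans.epi_iff_epi_app _).2 fun c => (AddCommGrpCat.epi_iff_surjective _).2 fun n => ?_
  exact ⟨Finsupp.single (⟨c.unop, 𝟙 _⟩ : ArrowsFrom c.unop) n.down, coefficientSum_single _ _⟩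

theorem coefficientSum_arcBoundary {X : Type*} (y : X × X →₀ ℤ) :
    coefficientSum.{u} X (arcBoundary X y) = 0 := by
  have : (coefficientSum.{u} X).comp (arcBoundary X) = 0 := by
    ext p : 2
    simp
  exact DFunLike.congr_fun this y

theorem difference_comp_augmentation : difference (C := C) ≫ augmentation = 0 := by
  ext c : 2
  exact AddCommGrpCat.hom_ext (AddMonoidHom.ext fun y => coefficientSum_arcBoundary y)

/-- The complete graph is connected: cone every point off to a base point `b`. -/
theorem exists_arcBoundary_eq {X : Type*} [Nonempty X] (x : X →₀ ℤ)
    (hx : coefficientSum.{u} X x = 0) : ∃ y : X × X →₀ ℤ, arcBoundary X y = x := by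
  obtain ⟨b⟩ := ‹Nonempty X›
  have key : ∀ x : X →₀ ℤ,
      ∃ y, arcBoundary _ y = x - Finsupp.single b (coefficientSum.{u} X x).down := by
    intro x
    induction x using Finsupp.induction_linear with
    | zero => exact ⟨0, by simp⟩
    | add x y hx hy =>
      obtain ⟨x', hx'⟩ := hx
      obtain ⟨y', hy'⟩ := hy
      refine ⟨x' + y', ?_⟩
      simp [hx', hy']
      abel
    | single a n => exact ⟨Finsupp.single (a, b) n, by simp⟩
  obtain ⟨y, hy⟩ := key x
  exact ⟨y, by simp [hy, hx]⟩

/-- The kernel of the augmentation is projective, so the surjection `D` onto it splits. The chain `σ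
c x y` is the image under the splitting of the kernel element `x - y`; additivity and naturality are
inherited from that element. -/
theorem exists_natural_arcs (h : HasProjectiveDimensionLT (constIntModule C) 2) :
    ∃ σ : ∀ c : C, ArrowsFrom c → ArrowsFrom c → (ArrowsFrom c × ArrowsFrom c →₀ ℤ),
      (∀ c x y z, σ c x y + σ c y z = σ c x z) ∧
      (∀ c x y, arcBoundary _ (σ c x y) = Finsupp.single x 1 - Finsupp.single y 1) ∧
      ∀ {c d : C} (f : c ⟶ d) (x y), σ c (x.precomp f) (y.precomp f) =
        Finsupp.mapDomain (Prod.map (.precomp f) (.precomp f)) (σ d x y) := by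
  let K := Limits.kernel (augmentation (C := C))
  let i : K ⟶ freeArrows C := Limits.kernel.ι _
  let S : ShortComplex (CatModule C) := ShortComplex.mk i augmentation (by simp [i])
  have hS : S.ShortExact :=
    { exact := ShortComplex.exact_kernel _
      mono_f := by dsimp [S, i]; infer_instance
      epi_g := by dsimp [S]; infer_instance }
  have hproj : Projective K :=
    projective_iff_hasProjectiveDimensionLT_one.2
      (hS.hasProjectiveDimensionLT_X₁ 1 (by dsimp [S]; infer_instance) h)
  let D : freeArrowPairs C ⟶ K := Limits.kernel.lift _ difference difference_comp_augmentation
  have hD : D ≫ i = difference := Limits.kernel.lift_ι _ _ _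
  have hinj : ∀ c, Function.Injective (i.app c) := fun c =>
    (AddCommGrpCat.mono_iff_injective _).1
      ((NatTrans.mono_iff_mono_app i).1 (by dsimp [i]; infer_instance) c)
  let D' : ∀ c : C, (ArrowsFrom c × ArrowsFrom c →₀ ℤ) →+ K.obj (.op c) :=
    fun c => (D.app (.op c)).hom
  let i' : ∀ c : C, K.obj (.op c) →+ (ArrowsFrom c →₀ ℤ) := fun c => (i.app (.op c)).hom
  have hDc : ∀ c y, i' c (D' c y) = arcBoundary _ y := fun c y =>
    ConcreteCategory.congr_hom (NatTrans.congr_app hD (.op c)) y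
  have hepi : Epi D := by
    refine (NatTrans.epi_iff_epi_app _).2 fun c =>
      (AddCommGrpCat.epi_iff_surjective _).2 fun k => ?_
    have : Nonempty (ArrowsFrom c.unop) := ⟨⟨c.unop, 𝟙 _⟩⟩
    obtain ⟨y, hy⟩ := exists_arcBoundary_eq (i.app c k)
      (ConcreteCategory.congr_hom
        (NatTrans.congr_app (Limits.kernel.condition (augmentation (C := C))) c) k)
    exact ⟨y, hinj c ((hDc c.unop y).trans hy)⟩
  let s : K ⟶ freeArrowPairs C := Projective.factorThru (𝟙 K) D
  have hs : s ≫ D = 𝟙 _ := Projective.factorThru_comp _ _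
  let s' : ∀ c : C, K.obj (.op c) →+ (ArrowsFrom c × ArrowsFrom c →₀ ℤ) :=
    fun c => (s.app (.op c)).hom
  have hsc : ∀ c k, D' c (s' c k) = k := fun c k =>
    ConcreteCategory.congr_hom (NatTrans.congr_app hs (.op c)) k
  refine ⟨fun c x y => s' c (D' c (Finsupp.single (x, y) 1)), ?_, ?_, ?_⟩
  · intro c x y z
    have : D' c (Finsupp.single (x, y) 1) + D' c (Finsupp.single (y, z) 1) =
        D' c (Finsupp.single (x, z) 1) := by
      apply hinj
      change i' c _ = i' c _
      rw [map_add, hDc, hDc, hDc]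
      simp
    simp only [← this, map_add]
  · intro c x y
    rw [← hDc, hsc, hDc]
    simp
  · intro c d f x y
    have h1 := NatTrans.naturality_apply s f.op (D' d (Finsupp.single (x, y) 1))
    have h2 := NatTrans.naturality_apply D f.op (Finsupp.single (x, y) (1 : ℤ))
    have h3 : (freeArrowPairs C).map f.op (Finsupp.single (x, y) (1 : ℤ)) =
        Finsupp.single (x.precomp f, y.precomp f) (1 : ℤ) := Finsupp.mapDomain_single
    refine Eq.trans ?_ h1
    exact congrArg (s' c) ((congrArg (D' c) h3).symm.trans h2)

end CatModule

/-! ### Arc sections on sets with a group action. -/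

/-- A natural choice of a `1`-chain from `y` to `x` for all points `x`, `y` of a `G`-set: it is
additive, equivariant, and fixed pointwise by all group elements that fix `x` and `y`. -/
structure ArcSection (G X : Type*) [Group G] [MulAction G X] where
  arc : X → X → (X × X →₀ ℤ)
  arc_add : ∀ x y z, arc x y + arc y z = arc x z
  boundary : ∀ x y, arcBoundary X (arc x y) = Finsupp.single x 1 - Finsupp.single y 1
  arc_smul : ∀ (g : G) x y, arc (g • x) (g • y) = Finsupp.mapDomain (Prod.map (g • ·) (g • ·)) (arc x y)
  fixed : ∀ (g : G) x y, g • x = x → g • y = y →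
    ∀ p ∈ (arc x y).support, g • p.1 = p.1 ∧ g • p.2 = p.2

namespace ArcSection

variable {G X : Type*} [Group G] [MulAction G X] (σ : ArcSection G X)

/-- Restriction of an arc section to a subgroup. -/
def restrict (K : Subgroup G) : ArcSection K X where
  arc := σ.arc
  arc_add := σ.arc_add
  boundary := σ.boundary
  arc_smul g := σ.arc_smul g
  fixed g := σ.fixed g

@[simp]
theorem arc_self (x : X) : σ.arc x x = 0 := by
  simpa using σ.arc_add x x x

theorem arc_sub (x y z : X) : σ.arc x z - σ.arc y z = σ.arc x y := by
  rw [← σ.arc_add x y z, add_sub_cancel_right]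

end ArcSection

/-! ### From modules over the orbit category to an arc section. -/

namespace OrbitCategory

open CatModule

variable {Γ : Type u} [Group Γ] {F : SubgroupFamily Γ}

variable (F) in
/-- The disjoint union of all orbits in a family. -/
abbrev Points : Type u := Σ O : OrbitCategory F, Γ ⧸ O.subgroup

/-- The image of the base point under an arrow. -/
def pointOf {O : OrbitCategory F} (a : ArrowsFrom O) : Points F :=
  ⟨a.1, (show (Γ ⧸ O.subgroup) →[Γ] (Γ ⧸ a.1.subgroup) from a.2) (1 : Γ)⟩

/-- The equivariant map sending the base point to a given fixed point. -/
def homOfFixed {O O' : OrbitCategory F} (q : Γ ⧸ O'.subgroup) (hq : ∀ g ∈ O.subgroup, g • q = q) :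
    O ⟶ O' :=
  show (Γ ⧸ O.subgroup) →[Γ] (Γ ⧸ O'.subgroup) from
  { toFun := Quotient.lift (fun g : Γ => g • q) fun a b hab => by
      have h := hq _ (QuotientGroup.leftRel_apply.1 hab)
      rw [mul_smul, inv_smul_eq_iff] at h
      exact h.symm
    map_smul' := fun g x => by
      induction x using QuotientGroup.induction_on with
      | H x => exact mul_smul g x q }

/-- The arrow sending the base point to a given fixed point. -/
def arrowOfFixed (O : OrbitCategory F) (x : Points F) (hx : ∀ g ∈ O.subgroup, g • x.2 = x.2) :
    ArrowsFrom O :=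
  ⟨x.1, homOfFixed x.2 hx⟩

theorem pointOf_arrowOfFixed (O : OrbitCategory F) (x : Points F)
    (hx : ∀ g ∈ O.subgroup, g • x.2 = x.2) : pointOf (arrowOfFixed O x hx) = x := by
  obtain ⟨O', q⟩ := x
  exact congrArg (Sigma.mk O') (one_smul Γ q)

theorem pointOf_injective (O : OrbitCategory F) :
    Function.Injective (pointOf : ArrowsFrom O → Points F) := by
  rintro ⟨O₁, f⟩ ⟨O₂, f'⟩ h
  obtain rfl : O₁ = O₂ := congrArg Sigma.fst h
  have h' := eq_of_heq (Sigma.mk.inj h).2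
  congr 1
  refine MulActionHom.ext (f := f) (g := f') fun x => ?_
  induction x using QuotientGroup.induction_on with
  | H x =>
    have e : ((x : Γ) : Γ ⧸ O.subgroup) = x • ((1 : Γ) : Γ ⧸ O.subgroup) := by
      simp
    rw [e]
    exact ((map_smul (show (Γ ⧸ O.subgroup) →[Γ] (Γ ⧸ O₁.subgroup) from f) x _).trans
      (congrArg (x • ·) h')).trans
      (map_smul (show (Γ ⧸ O.subgroup) →[Γ] (Γ ⧸ O₁.subgroup) from f') x _).symm

theorem smul_pointOf {O : OrbitCategory F} (a : ArrowsFrom O) {g : Γ} (hg : g ∈ O.subgroup) :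
    g • pointOf a = pointOf a := by
  refine congrArg (Sigma.mk a.1) ?_
  refine (map_smul (show (Γ ⧸ O.subgroup) →[Γ] (Γ ⧸ a.1.subgroup) from a.2) g _).symm.trans ?_
  refine congrArg (show (Γ ⧸ O.subgroup) →[Γ] (Γ ⧸ a.1.subgroup) from a.2) ?_
  have := MulAction.stabilizer_quotient O.subgroup
  rw [← this] at hg
  exact hg

theorem pointOf_precomp_homOfFixed {O O' : OrbitCategory F} (g : Γ)
    (hg : ∀ h ∈ O.subgroup, h • (g : Γ ⧸ O'.subgroup) = g) (a : ArrowsFrom O') :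
    pointOf (a.precomp (homOfFixed (O := O) (g : Γ ⧸ O'.subgroup) hg)) = g • pointOf a := by
  refine congrArg (Sigma.mk a.1) ?_
  refine Eq.trans ?_ (map_smul (show (Γ ⧸ O'.subgroup) →[Γ] (Γ ⧸ a.1.subgroup) from a.2) g _)
  refine congrArg (show (Γ ⧸ O'.subgroup) →[Γ] (Γ ⧸ a.1.subgroup) from a.2) ?_
  change (1 : Γ) • (g : Γ ⧸ O'.subgroup) = g • ((1 : Γ) : Γ ⧸ O'.subgroup)
  simp

theorem stabilizer_mem (x : Points F) : MulAction.stabilizer Γ x ∈ F.carrier := by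
  obtain ⟨O, q⟩ := x
  have h : MulAction.stabilizer Γ (⟨O, q⟩ : Points F) = MulAction.stabilizer Γ q := by
    ext g
    simp [MulAction.mem_stabilizer_iff]
  rw [h]
  induction q using QuotientGroup.induction_on with
  | H a =>
    have e : ((a : Γ) : Γ ⧸ O.subgroup) = a • ((1 : Γ) : Γ ⧸ O.subgroup) := by simp
    rw [e, MulAction.stabilizer_smul_eq_stabilizer_map_conj, MulAction.stabilizer_quotient]
    exact F.conj_mem _ O.mem a

theorem exists_fixed {H : Subgroup Γ} (hH : H ∈ F.carrier) :
    ∃ x : Points F, ∀ g ∈ H, g • x = x :=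
  ⟨pointOf (⟨⟨H, hH⟩, 𝟙 _⟩ : ArrowsFrom (⟨H, hH⟩ : OrbitCategory F)), fun _ hg => smul_pointOf _ hg⟩

/-- Arrows out of `Γ/H` correspond to the points fixed by `H`. Hence all points are seen from `Γ/1`,
and naturality along its endomorphisms is equivariance. -/
theorem nonempty_arcSection
    (h : HasProjectiveDimensionLT (constIntModule (OrbitCategory F)) 2) :
    Nonempty (ArcSection Γ (Points F)) := by
  obtain ⟨σ, hadd, hbd, hnat⟩ := exists_natural_arcs h
  have hbot : (⊥ : Subgroup Γ) ∈ F.carrier := by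
    obtain ⟨H, hH⟩ := F.nonempty
    exact F.mem_of_le H hH ⊥ bot_le
  let o : OrbitCategory F := ⟨⊥, hbot⟩
  let a : Points F → ArrowsFrom o := fun x => arrowOfFixed o x (by
    rintro g (hg : g ∈ (⊥ : Subgroup Γ))
    rw [Subgroup.mem_bot.1 hg, one_smul])
  have ha : ∀ x, pointOf (a x) = x := fun x => pointOf_arrowOfFixed _ _ _
  have hfix : ∀ (O : OrbitCategory F) (g : Γ), ∀ h ∈ o.subgroup,
      h • (g : Γ ⧸ O.subgroup) = g := by
    rintro O g h (hh : h ∈ (⊥ : Subgroup Γ))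
    rw [Subgroup.mem_bot.1 hh, one_smul]
  refine ⟨⟨fun x y => Finsupp.mapDomain (Prod.map pointOf pointOf) (σ o (a x) (a y)),
    ?_, ?_, ?_, ?_⟩⟩
  · intro x y z
    rw [← Finsupp.mapDomain_add, hadd]
  · intro x y
    rw [arcBoundary_mapDomain, hbd, Finsupp.mapDomain_sub, Finsupp.mapDomain_single,
      Finsupp.mapDomain_single, ha, ha]
  · intro g x y
    have hsm : ∀ x, a (g • x) = (a x).precomp (homOfFixed _ (hfix o g)) := fun x =>
      pointOf_injective _ (by rw [pointOf_precomp_homOfFixed, ha, ha])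
    rw [hsm, hsm, hnat, ← Finsupp.mapDomain_comp, ← Finsupp.mapDomain_comp]
    congr 1
    exact funext fun p => Prod.ext (pointOf_precomp_homOfFixed g _ _) (pointOf_precomp_homOfFixed g _ _)
  · intro g x y hgx hgy p hp
    -- Both points already come from arrows out of `Γ/L`, so by naturality along `Γ/1 → Γ/L` the
    -- chain does too, and its support consists of `L`-fixed points.
    let L : Subgroup Γ := MulAction.stabilizer Γ x ⊓ MulAction.stabilizer Γ y
    let O : OrbitCategory F := ⟨L, F.mem_of_le _ (stabilizer_mem x) _ inf_le_left⟩
    have key : ∀ z : Points F, L ≤ MulAction.stabilizer Γ z →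
        ∃ b : ArrowsFrom O, a z = b.precomp (homOfFixed _ (hfix O 1)) := by
      intro z hz
      refine ⟨arrowOfFixed O z fun g hg => ?_, pointOf_injective _ ?_⟩
      · exact eq_of_heq (Sigma.mk.inj (hz hg)).2
      · rw [pointOf_precomp_homOfFixed, ha, pointOf_arrowOfFixed, one_smul]
    obtain ⟨b, hb⟩ := key x inf_le_left
    obtain ⟨c, hc⟩ := key y inf_le_right
    rw [hb, hc, hnat, ← Finsupp.mapDomain_comp] at hp
    classical
    obtain ⟨⟨q, r⟩, -, rfl⟩ := Finset.mem_image.1 (Finsupp.mapDomain_support hp)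
    have hg : g ∈ O.subgroup := ⟨hgx, hgy⟩
    simp [pointOf_precomp_homOfFixed, smul_pointOf _ hg]

end OrbitCategory

/-! ### Transfer of arc sections and the winding number argument. -/

theorem Finsupp.addMonoidHom_eq_of_eqOn_support {α M : Type*} [AddCommGroup M]
    {f g : (α →₀ ℤ) →+ M} {c : α →₀ ℤ}
    (h : ∀ p ∈ c.support, f (Finsupp.single p 1) = g (Finsupp.single p 1)) : f c = g c := by
  rw [← Finsupp.sum_single c, Finsupp.sum, map_sum, map_sum]
  refine Finset.sum_congr rfl fun p hp => ?_
  rw [← mul_one (c p), ← smul_eq_mul, ← Finsupp.smul_single, map_zsmul, map_zsmul, h p hp]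

namespace MulAction

/-- An equivariant map exists as soon as every stabilizer fixes a point of the target. -/
theorem exists_equivariant_of_stabilizer_le {G A B : Type*} [Group G] [MulAction G A] [MulAction G B]
    (h : ∀ a : A, ∃ b : B, stabilizer G a ≤ stabilizer G b) :
    ∃ f : A → B, ∀ (g : G) a, f (g • a) = g • f a := by
  choose b hb using h
  let r : A → A := fun a => (Quotient.mk (orbitRel G A) a).out
  have hr : ∀ a, ∃ g : G, g • r a = a := fun a =>
    orbitRel_apply.1 ((orbitRel G A).symm (Quotient.mk_out (s := orbitRel G A) a))
  have hrs : ∀ (g : G) a, r (g • a) = r a := fun g a =>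
    congrArg Quotient.out (Quotient.sound (s := orbitRel G A) (orbitRel_apply.2 ⟨g, rfl⟩))
  choose k hk using hr
  refine ⟨fun a => k a • b (r a), fun g a => ?_⟩
  have h1 : k (g • a) • r a = (g * k a) • r a := by
    rw [mul_smul, hk, ← hrs g a, hk]
  have h2 : (g * k a)⁻¹ * k (g • a) ∈ stabilizer G (r a) := by
    rw [mem_stabilizer_iff, mul_smul, h1, inv_smul_smul]
  have h3 := hb _ h2
  rw [mem_stabilizer_iff, mul_smul, inv_smul_eq_iff] at h3
  change k (g • a) • b (r (g • a)) = g • k a • b (r a)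
  rw [hrs, h3, mul_smul]

end MulAction

namespace ArcSection

variable {G A B : Type*} [Group G] [MulAction G A] [MulAction G B]

/-- Arc sections can be transferred along equivariant maps in both directions. -/
theorem nonempty_of_equivariant (σ : ArcSection G B) {f : A → B} (hf : ∀ (g : G) a, f (g • a) = g • f a)
    {k : B → A} (hk : ∀ (g : G) b, k (g • b) = g • k b) : Nonempty (ArcSection G A) := by
  -- Carry the chain between `f x` and `f y` back by `k`, then join its ends to `x` and `y` by
  -- single arcs.
  refine ⟨⟨fun x y => Finsupp.single (x, k (f x)) 1 +
    Finsupp.mapDomain (Prod.map k k) (σ.arc (f x) (f y)) - Finsupp.single (y, k (f y)) 1,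
    ?_, ?_, ?_, ?_⟩⟩
  · intro x y z
    rw [← σ.arc_add (f x) (f y) (f z), Finsupp.mapDomain_add]
    abel
  · intro x y
    rw [map_sub, map_add, arcBoundary_mapDomain, σ.boundary, Finsupp.mapDomain_sub]
    simp [Finsupp.mapDomain_single]
  · intro g x y
    rw [Finsupp.mapDomain_sub, Finsupp.mapDomain_add, hf, hf, σ.arc_smul,
      ← Finsupp.mapDomain_comp, ← Finsupp.mapDomain_comp]
    simp only [Finsupp.mapDomain_single, Prod.map, hk]
    congr 3
    funext p
    simp [Prod.map, hk]
  · intro g x y hx hy p hp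
    have hsing : ∀ z : A, g • z = z → ∀ p ∈ (Finsupp.single (z, k (f z)) (1 : ℤ)).support,
        g • p.1 = p.1 ∧ g • p.2 = p.2 := by
      intro z hz p hp
      obtain rfl := Finset.mem_singleton.1 (Finsupp.support_single_subset hp)
      exact ⟨hz, by rw [← hk, ← hf, hz]⟩
    classical
    rcases Finset.mem_union.1 (Finsupp.support_sub hp) with hp | hp
    · rcases Finset.mem_union.1 (Finsupp.support_add hp) with hp | hp
      · exact hsing x hx p hp
      · obtain ⟨q, hq, rfl⟩ := Finset.mem_image.1 (Finsupp.mapDomain_support hp)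
        obtain ⟨h1, h2⟩ := σ.fixed g (f x) (f y) (by rw [← hf, hx]) (by rw [← hf, hy]) q hq
        exact ⟨by simp [Prod.map, ← hk, h1], by simp [Prod.map, ← hk, h2]⟩
    · exact hsing y hy p hp

theorem arc_pow_smul (σ : ArcSection G A) (g : G) (x : A) (m : ℕ) :
    σ.arc (g ^ m • x) x = ∑ i ∈ Finset.range m,
      Finsupp.mapDomain (Prod.map (g ^ i • ·) (g ^ i • ·)) (σ.arc (g • x) x) := by
  induction m with
  | zero => simp
  | succ m ih =>
    rw [Finset.sum_range_succ, ← ih, ← σ.arc_smul, smul_smul, ← pow_succ, add_comm (σ.arc (g ^ m • x) x),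
      σ.arc_add]

/-- A function on a `G`-set that increases by one, modulo the order of `g` modulo `H`, under the
action of `g` on points with stabilizer `H`. -/
theorem exists_phase (H : Subgroup G) [H.Normal] (g : G) :
    ∃ h : A → ZMod (orderOf (g : G ⧸ H)), ∀ x, MulAction.stabilizer G x = H →
      h (g • x) = h x + 1 := by
  let Z := Subgroup.zpowers g
  let r : A → A := fun a => (Quotient.mk (MulAction.orbitRel Z A) a).out
  have hr : ∀ a, ∃ i : ℤ, g ^ i • r a = a := fun a => by
    obtain ⟨⟨-, i, rfl⟩, h⟩ := MulAction.orbitRel_apply.1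
      ((MulAction.orbitRel Z A).symm (Quotient.mk_out (s := MulAction.orbitRel Z A) a))
    exact ⟨i, h⟩
  have hrs : ∀ a, r (g • a) = r a := fun a =>
    congrArg Quotient.out (Quotient.sound (s := MulAction.orbitRel Z A)
      (MulAction.orbitRel_apply.2 ⟨⟨g, Subgroup.mem_zpowers g⟩, rfl⟩))
  choose i hi using hr
  -- The phase is the exponent carrying the chosen representative of the `⟨g⟩`-orbit to `x`; it is
  -- well defined modulo `n` where the stabilizer is `H`.
  refine ⟨fun x => (i x : ZMod _), fun x hx => ?_⟩
  have hstab : MulAction.stabilizer G (r x) = H := by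
    have : r x = g ^ (-i x) • x := by
      rw [zpow_neg, eq_inv_smul_iff, hi]
    rw [this, MulAction.stabilizer_smul_eq_stabilizer_map_conj, hx]
    exact Subgroup.Normal.map_conj_eq H _
  have h1 : g ^ (i x + 1) • r x = g ^ i (g • x) • r x := by
    rw [add_comm, zpow_add, mul_smul, hi, zpow_one, ← hrs x, hi]
  have h2 : g ^ (i (g • x) - (i x + 1)) ∈ H := by
    rw [← hstab, MulAction.mem_stabilizer_iff, sub_eq_neg_add, zpow_add, mul_smul, ← h1, zpow_neg,
      inv_smul_smul]
  have h3 : ((orderOf (g : G ⧸ H) : ℕ) : ℤ) ∣ i (g • x) - (i x + 1) := by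
    rw [orderOf_dvd_iff_zpow_eq_one, ← QuotientGroup.mk_zpow, QuotientGroup.eq_one_iff]
    exact h2
  have h4 := (ZMod.intCast_zmod_eq_zero_iff_dvd _ _).2 h3
  push_cast at h4
  exact sub_eq_zero.1 h4

/-- If `H` were normal, a chain between `x` and `g • x` would have phase change 1 modulo the order
`n > 1` of `g` in `G ⧸ H`. Its `n` translates add up to the chain from `x` to `g ^ n • x = x`, which
is zero, and this sum recovers the phase change. -/
theorem not_normal_stabilizer [Finite G] (σ : ArcSection G A) (H : Subgroup G) (hH : H ≠ ⊤)
    (hmax : ∀ x : A, H ≤ MulAction.stabilizer G x → MulAction.stabilizer G x = H)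
    (x : A) (hx : H ≤ MulAction.stabilizer G x) : ¬ H.Normal := by
  intro hn
  obtain ⟨g, hg⟩ : ∃ g, g ∉ H := by
    by_contra! h
    exact hH ((Subgroup.eq_top_iff' H).2 h)
  have hphase := exists_phase (A := A) H g
  set n := orderOf (g : G ⧸ H) with hndef
  obtain ⟨h, hh⟩ := hphase
  have hn0 : n ≠ 0 := (orderOf_pos (g : G ⧸ H)).ne'
  have : NeZero n := ⟨hn0⟩
  have hn1 : n ≠ 1 := fun h => hg ((QuotientGroup.eq_one_iff g).1 (orderOf_eq_one_iff.1 h))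
  have hstab : ∀ y : A, H ≤ MulAction.stabilizer G y → ∀ k : G,
      H ≤ MulAction.stabilizer G (k • y) := by
    intro y hy k
    rw [MulAction.stabilizer_smul_eq_stabilizer_map_conj, hmax y hy]
    exact (Subgroup.Normal.map_conj_eq H k).ge
  have hpow : ∀ y : A, H ≤ MulAction.stabilizer G y → ∀ m : ℕ, h (g ^ m • y) = h y + m := by
    intro y hy m
    induction m with
    | zero => simp
    | succ m ih =>
      rw [pow_succ', mul_smul, hh _ (hmax _ (hstab y hy _)), ih]
      push_cast
      ring
  let ω : (A × A →₀ ℤ) →+ ZMod n :=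
    Finsupp.liftAddHom fun p => zmultiplesHom _ (h p.1 - h p.2)
  -- Unlike `ω`, this counts only arcs whose first point has phase 0.
  let ψ : (A × A →₀ ℤ) →+ ZMod n :=
    Finsupp.liftAddHom fun p => zmultiplesHom _ (if h p.1 = 0 then h p.1 - h p.2 else 0)
  let θ : (A →₀ ℤ) →+ ZMod n := Finsupp.liftAddHom fun y => zmultiplesHom _ (h y)
  have hθ : ∀ c, ω c = θ (arcBoundary A c) := by
    intro c
    have : ω = θ.comp (arcBoundary A) := by
      ext p
      have : θ (Finsupp.single p.1 1 - Finsupp.single p.2 1) = h p.1 - h p.2 := by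
        rw [map_sub]
        simp [θ]
      simpa [ω] using this.symm
    rw [this]
    rfl
  have h1 : ω (σ.arc (g • x) x) = 1 := by
    rw [hθ, σ.boundary, map_sub]
    simp [θ, hh x (hmax x hx)]
  have h2 : ω (σ.arc (g • x) x) = ψ (σ.arc (g ^ n • x) x) := by
    rw [σ.arc_pow_smul, map_sum]
    let τ : ℕ → (A × A →₀ ℤ) →+ (A × A →₀ ℤ) := fun i =>
      Finsupp.mapDomain.addMonoidHom (Prod.map (g ^ i • ·) (g ^ i • ·))
    -- Among the `n` translates of an arc between `H`-fixed points exactly one has first point of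
    -- phase 0, and translation preserves phase differences.
    have key : ω (σ.arc (g • x) x) = (∑ i ∈ Finset.range n, ψ.comp (τ i)) (σ.arc (g • x) x) := by
      refine Finsupp.addMonoidHom_eq_of_eqOn_support fun p hp => ?_
      have hp1 : H ≤ MulAction.stabilizer G p.1 := fun k hk =>
        (σ.fixed k _ _ (hstab x hx g hk) (hx hk) p hp).1
      have hp2 : H ≤ MulAction.stabilizer G p.2 := fun k hk =>
        (σ.fixed k _ _ (hstab x hx g hk) (hx hk) p hp).2
      rw [AddMonoidHom.finsetSum_apply]
      have hterm : ∀ i ∈ Finset.range n, (ψ.comp (τ i)) (Finsupp.single p 1) =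
          if (-h p.1).val = i then h p.1 - h p.2 else 0 := by
        intro i hi
        have : h p.1 + (i : ZMod n) = 0 ↔ (-h p.1).val = i := by
          rw [add_eq_zero_iff_neg_eq]
          constructor
          · intro e
            rw [e, ZMod.val_natCast_of_lt (Finset.mem_range.1 hi)]
          · intro e
            rw [← e, ZMod.natCast_zmod_val]
        simp [ψ, τ, Finsupp.mapDomain_single, hpow _ hp1, hpow _ hp2, this]
      rw [Finset.sum_congr rfl hterm, Finset.sum_ite_eq, if_pos (Finset.mem_range.2 (ZMod.val_lt _))]
      simp [ω]
    rw [key, AddMonoidHom.finsetSum_apply]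
    rfl
  have h3 : g ^ n • x = x := by
    refine hx ?_
    rw [← QuotientGroup.eq_one_iff, QuotientGroup.mk_pow]
    exact pow_orderOf_eq_one _
  rw [h3, arc_self, map_zero, h1] at h2
  have h4 : ((1 : ℕ) : ZMod n) = 0 := by exact_mod_cast h2
  exact hn1 (Nat.dvd_one.1 ((ZMod.natCast_eq_zero_iff 1 n).1 h4))

end ArcSection

/-! ### Maximal subgroups under conjugation. -/

/-- The maximal proper subgroups of a group. -/
abbrev Coatom (G : Type*) [Group G] := {H : Subgroup G // IsCoatom H}

namespace Coatom

variable {G : Type*} [Group G]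

/-- The conjugation action on the maximal subgroups. -/
instance : MulAction G (Coatom G) where
  smul g H := ⟨(MulAut.conj g).mapSubgroup H.1, ((MulAut.conj g).mapSubgroup.isCoatom_iff _).2 H.2⟩
  one_smul H := by
    refine Subtype.ext (Subgroup.ext fun x => ?_)
    change x ∈ Subgroup.map _ _ ↔ _
    simp [Subgroup.mem_map]
  mul_smul g k H := by
    refine Subtype.ext (Subgroup.ext fun x => ?_)
    change x ∈ Subgroup.map _ _ ↔ x ∈ Subgroup.map _ (Subgroup.map _ _)
    simp [Subgroup.mem_map, mul_assoc]

theorem mem_mapSubgroup_conj {g x : G} {H : Subgroup G} :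
    x ∈ (MulAut.conj g).mapSubgroup H ↔ g⁻¹ * x * g ∈ H := by
  change x ∈ Subgroup.map _ _ ↔ _
  rw [Subgroup.mem_map]
  constructor
  · rintro ⟨y, hy, rfl⟩
    simpa [mul_assoc] using hy
  · intro h
    exact ⟨_, h, by simp [mul_assoc]⟩

theorem coe_smul (g : G) (H : Coatom G) : (g • H).1 = (MulAut.conj g).mapSubgroup H.1 := rfl

theorem smul_eq_of_mem {g : G} {H : Coatom G} (hg : g ∈ H.1) : g • H = H := by
  refine Subtype.ext (Subgroup.ext fun x => mem_mapSubgroup_conj.trans ?_)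
  rw [H.1.mul_mem_cancel_right hg, H.1.mul_mem_cancel_left (H.1.inv_mem hg)]

theorem eq_of_le {H H' : Coatom G} (h : H.1 ≤ H'.1) : H = H' := by
  rcases h.eq_or_lt with h | h
  · exact Subtype.ext h
  · exact absurd (H.2.2 _ h) H'.2.1

/-- The stabilizer of `H` is its normalizer, which contains the maximal subgroup `H` and is not
everything. -/
theorem smul_eq_iff (hN : ∀ H : Coatom G, ¬ H.1.Normal) {g : G} {H : Coatom G} :
    g • H = H ↔ g ∈ H.1 := by
  refine ⟨fun h => ?_, smul_eq_of_mem⟩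
  have hle : H.1 ≤ MulAction.stabilizer G H := fun k hk => smul_eq_of_mem hk
  rcases hle.eq_or_lt with e | e
  · exact e.ge h
  · refine absurd ⟨fun x hx k => ?_⟩ (hN H)
    have hk : k • H = H := by
      change k ∈ MulAction.stabilizer G H
      rw [H.2.2 _ e]
      trivial
    have := congrArg Subtype.val hk
    rw [← this, coe_smul, mem_mapSubgroup_conj]
    simpa [mul_assoc] using hx

theorem nonempty_arcSection [Finite G] {X : Type*} [MulAction G X] (σ : ArcSection G X)
    (hfix : ∀ H : Subgroup G, H ≠ ⊤ → ∃ x : X, H ≤ MulAction.stabilizer G x)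
    (hstab : ∀ x : X, MulAction.stabilizer G x ≠ ⊤) :
    (∀ H : Coatom G, ¬ H.1.Normal) ∧ Nonempty (ArcSection G (Coatom G)) := by
  have hN : ∀ H : Coatom G, ¬ H.1.Normal := by
    intro H
    obtain ⟨x, hx⟩ := hfix H.1 H.2.1
    refine σ.not_normal_stabilizer H.1 H.2.1 (fun y hy => ?_) x hx
    rcases hy.eq_or_lt with e | e
    · exact e.symm
    · exact absurd (H.2.2 _ e) (hstab y)
  refine ⟨hN, ?_⟩
  obtain ⟨f, hf⟩ := MulAction.exists_equivariant_of_stabilizer_le (G := G) (A := Coatom G) (B := X)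
    fun H => by
      obtain ⟨x, hx⟩ := hfix H.1 H.2.1
      exact ⟨x, fun g hg => hx ((smul_eq_iff hN).1 hg)⟩
  obtain ⟨k, hk⟩ := MulAction.exists_equivariant_of_stabilizer_le (G := G) (A := X) (B := Coatom G)
    fun x => by
      obtain ⟨H, hH, hle⟩ := (eq_top_or_exists_le_coatom (MulAction.stabilizer G x)).resolve_left
        (hstab x)
      exact ⟨⟨H, hH⟩, fun g hg => smul_eq_of_mem (hle hg)⟩
  exact σ.nonempty_of_equivariant hf hk

/-! ### Maximal branching subgroups. -/

/-- A subgroup is branching if it is contained in at least two maximal subgroups. -/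
def IsBranching (L : Subgroup G) : Prop :=
  ∃ H H' : Coatom G, H ≠ H' ∧ L ≤ H.1 ∧ L ≤ H'.1

variable (G) in
/-- The maximal branching subgroups. -/
abbrev Node := {L : Subgroup G // Maximal IsBranching L}

variable (G) in
/-- The maximal subgroups containing a maximal branching subgroup. -/
abbrev Vertex := {H : Coatom G // ∃ L : Node G, L.1 ≤ H.1}

variable (G) in
/-- The incidences between maximal branching subgroups and maximal subgroups. -/
abbrev Incidence := {e : Vertex G × Node G // e.2.1 ≤ e.1.1.1}

theorem IsBranching.conj {L : Subgroup G} (hL : IsBranching L) (g : G) :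
    IsBranching ((MulAut.conj g).mapSubgroup L) := by
  obtain ⟨H, H', hne, h, h'⟩ := hL
  exact ⟨g • H, g • H', fun e => hne (smul_left_cancel g e),
    (MulAut.conj g).mapSubgroup.monotone h, (MulAut.conj g).mapSubgroup.monotone h'⟩

/-- The conjugate of a maximal branching subgroup. -/
def Node.conj (L : Node G) (g : G) : Node G := by
  refine ⟨(MulAut.conj g).mapSubgroup L.1, L.2.1.conj g, fun M hM hLM => ?_⟩
  have h1 := hM.conj g⁻¹
  have h2 : L.1 ≤ (MulAut.conj g⁻¹).mapSubgroup M := fun x hx => by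
    rw [mem_mapSubgroup_conj]
    exact hLM (mem_mapSubgroup_conj.2 (by simpa [mul_assoc] using hx))
  intro x hx
  rw [mem_mapSubgroup_conj]
  exact L.2.2 h1 h2 (mem_mapSubgroup_conj.2 (by simpa [mul_assoc] using hx))

theorem Node.inf_le (L : Node G) {H H' : Coatom G} (hne : H ≠ H') (h : L.1 ≤ H.1) (h' : L.1 ≤ H'.1) :
    H.1 ⊓ H'.1 ≤ L.1 :=
  L.2.2 ⟨H, H', hne, inf_le_left, inf_le_right⟩ (le_inf h h')

/-- Two distinct maximal subgroups above a node intersect exactly in that node. -/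
theorem Node.eq_of_le (L L' : Node G) {H H' : Coatom G} (hne : H ≠ H') (h : L.1 ≤ H.1)
    (h' : L.1 ≤ H'.1) (k : L'.1 ≤ H.1) (k' : L'.1 ≤ H'.1) : L = L' :=
  Subtype.ext (le_antisymm ((le_inf h h').trans (L'.inf_le hne k k'))
    ((le_inf k k').trans (L.inf_le hne h h')))

theorem Node.exists_ne (L : Node G) (H : Coatom G) : ∃ H' : Coatom G, H' ≠ H ∧ L.1 ≤ H'.1 := by
  obtain ⟨H₁, H₂, hne, h₁, h₂⟩ := L.2.1
  by_cases e : H₁ = H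
  · exact ⟨H₂, fun e' => hne (e.trans e'.symm), h₂⟩
  · exact ⟨H₁, e, h₁⟩

theorem nonempty_node [Finite G] [Nontrivial G] (hN : ∀ H : Coatom G, ¬ H.1.Normal) :
    Nonempty (Node G) := by
  obtain ⟨H, hH, -⟩ := (eq_top_or_exists_le_coatom (⊥ : Subgroup G)).resolve_left bot_ne_top
  obtain ⟨g, hg⟩ : ∃ g, g ∉ H := by
    by_contra! h
    exact hH.1 ((Subgroup.eq_top_iff' H).2 h)
  have hb : IsBranching (⊥ : Subgroup G) :=
    ⟨g • ⟨H, hH⟩, ⟨H, hH⟩, fun e => hg ((smul_eq_iff hN).1 e), bot_le, bot_le⟩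
  obtain ⟨L, -, hL⟩ := (Set.toFinite {L : Subgroup G | IsBranching L}).exists_le_maximal hb
  exact ⟨⟨L, hL⟩⟩

/-! ### Projection of chains to the part above a node. -/

section Projection

variable (σ : ArcSection G (Coatom G))

open Classical in
/-- The boundary of the part of a `1`-chain that lies above a given subgroup. -/
noncomputable def boundaryAbove (L : Subgroup G) :
    (Coatom G × Coatom G →₀ ℤ) →+ (Coatom G →₀ ℤ) :=
  Finsupp.liftAddHom fun p =>
    if L ≤ p.1.1 ∧ L ≤ p.2.1 then Finsupp.singleAddHom p.1 - Finsupp.singleAddHom p.2 else 0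

theorem le_of_mem_support (hN : ∀ H : Coatom G, ¬ H.1.Normal) {L : Subgroup G} {H H' : Coatom G}
    (h : L ≤ H.1) (h' : L ≤ H'.1) {p : Coatom G × Coatom G} (hp : p ∈ (σ.arc H H').support) :
    L ≤ p.1.1 ∧ L ≤ p.2.1 := by
  have key := fun g hg => σ.fixed g H H' (smul_eq_of_mem (h hg)) (smul_eq_of_mem (h' hg)) p hp
  exact ⟨fun g hg => (smul_eq_iff hN).1 (key g hg).1, fun g hg => (smul_eq_iff hN).1 (key g hg).2⟩

theorem boundaryAbove_arc (hN : ∀ H : Coatom G, ¬ H.1.Normal) {L : Subgroup G} {H H' : Coatom G}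
    (h : L ≤ H.1) (h' : L ≤ H'.1) :
    boundaryAbove L (σ.arc H H') = Finsupp.single H 1 - Finsupp.single H' 1 := by
  rw [← σ.boundary]
  refine Finsupp.addMonoidHom_eq_of_eqOn_support fun p hp => ?_
  simp [boundaryAbove, le_of_mem_support σ hN h h' hp]

/-- Every arc in the chain has both ends above `L'`. If they also lie above `L ≠ L'`, the ends
coincide and the arc is a loop, with zero boundary. -/
theorem boundaryAbove_arc_of_ne (hN : ∀ H : Coatom G, ¬ H.1.Normal) {L L' : Node G} (hne : L' ≠ L)
    {H H' : Coatom G} (h : L'.1 ≤ H.1) (h' : L'.1 ≤ H'.1) :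
    boundaryAbove L.1 (σ.arc H H') = 0 := by
  change _ = (0 : (Coatom G × Coatom G →₀ ℤ) →+ (Coatom G →₀ ℤ)) (σ.arc H H')
  refine Finsupp.addMonoidHom_eq_of_eqOn_support fun p hp => ?_
  obtain ⟨h1, h2⟩ := le_of_mem_support σ hN h h' hp
  by_cases e : p.1 = p.2
  · simp [boundaryAbove, e]
  · have : ¬ (L.1 ≤ p.1.1 ∧ L.1 ≤ p.2.1) := fun hh =>
      hne (Node.eq_of_le L' L e h1 h2 hh.1 hh.2)
    simp [boundaryAbove, this]

end Projection

end Coatom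

/-! ### The incidence graph is a forest. -/

theorem Finset.sum_smul_comp_eq_zero {E I M : Type*} [Fintype E] [DecidableEq I] [AddCommGroup M]
    (f : E → ℤ) (π : E → I) (hf : ∀ i, ∑ e, (if π e = i then f e else 0) = 0) (v : I → M) :
    ∑ e, f e • v (π e) = 0 := by
  rw [← Finset.sum_fiberwise_of_maps_to (t := Finset.univ.image π)
    (fun e _ => Finset.mem_image_of_mem π (Finset.mem_univ e))]
  refine Finset.sum_eq_zero fun i _ => ?_
  have : ∀ e ∈ Finset.univ.filter (fun e => π e = i), f e • v (π e) = f e • v i := fun e he => by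
    rw [(Finset.mem_filter.1 he).2]
  rw [Finset.sum_congr rfl this, ← Finset.sum_smul, Finset.sum_filter, hf, zero_smul]

namespace Coatom

variable {G : Type*} [Group G]

section Acyclic

-- Let `B` pick a maximal subgroup above each node. For a cycle `f`, the weighted sum of the chains
-- between `H` and `B L'` over incidences `(H, L')` vanishes by additivity. Projecting above `L`
-- leaves only the incidences at `L`; there the `B L` terms cancel, and the vertices `H` are
-- independent.
open Classical in
theorem eq_zero_of_incidence_sums [Fintype (Incidence G)] (σ : ArcSection G (Coatom G))
    (hN : ∀ H : Coatom G, ¬ H.1.Normal) (f : Incidence G → ℤ)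
    (hV : ∀ H : Vertex G, ∑ e, (if e.1.1 = H then f e else 0) = 0)
    (hC : ∀ L : Node G, ∑ e, (if e.1.2 = L then f e else 0) = 0) : f = 0 := by
  funext e₀
  set L := e₀.1.2 with hL
  have hB : ∀ L' : Node G, ∃ B : Coatom G, L'.1 ≤ B.1 := fun L' => by
    obtain ⟨H, -, -, h, -⟩ := L'.2.1
    exact ⟨H, h⟩
  choose B hB using hB
  have h1 : ∑ e, f e • boundaryAbove L.1 (σ.arc e.1.1.1 (B L)) = 0 :=
    Finset.sum_smul_comp_eq_zero f (fun e => e.1.1) hV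
      fun H => boundaryAbove L.1 (σ.arc H.1 (B L))
  have h2 : ∑ e, f e • boundaryAbove L.1 (σ.arc (B e.1.2) (B L)) = 0 :=
    Finset.sum_smul_comp_eq_zero f (fun e => e.1.2) hC
      fun L' => boundaryAbove L.1 (σ.arc (B L') (B L))
  have h3 : ∑ e, f e • boundaryAbove L.1 (σ.arc e.1.1.1 (B e.1.2)) = 0 := by
    rw [← sub_eq_zero.2 (h1.trans h2.symm), ← Finset.sum_sub_distrib]
    refine Finset.sum_congr rfl fun e _ => ?_
    rw [← smul_sub, ← map_sub, σ.arc_sub]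
  have h4 : ∑ e, f e • (if e.1.2 = L then Finsupp.single (B e.1.2) (1 : ℤ) else 0) = 0 :=
    Finset.sum_smul_comp_eq_zero f (fun e => e.1.2) hC
      fun L' => if L' = L then Finsupp.single (B L') (1 : ℤ) else 0
  have h5 : ∑ e, f e • (if e.1.2 = L then Finsupp.single e.1.1.1 (1 : ℤ) else 0) = 0 := by
    have := congrArg₂ (· + ·) h3 h4
    simp only [← Finset.sum_add_distrib, ← smul_add, add_zero] at this
    refine Eq.trans (Finset.sum_congr rfl fun e _ => ?_) this
    by_cases he : e.1.2 = L
    · rw [if_pos he, if_pos he, ← he, boundaryAbove_arc σ hN e.2 (hB _), sub_add_cancel]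
    · rw [if_neg he, if_neg he, boundaryAbove_arc_of_ne σ hN he e.2 (hB _), add_zero]
  have h6 := DFunLike.congr_fun h5 e₀.1.1.1
  rw [Finsupp.finsetSum_apply, Finset.sum_eq_single e₀] at h6
  · simpa [hL] using h6
  · intro e _ he
    by_cases he' : e.1.2 = L
    · have : e.1.1.1 ≠ e₀.1.1.1 := fun h =>
        he (Subtype.ext (Prod.ext (Subtype.ext h) he'))
      simp [he', this]
    · simp [he']
  · simp

open Classical in
theorem card_incidence_add_one_le [Fintype (Incidence G)] [Fintype (Vertex G)] [Fintype (Node G)]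
    [Nonempty (Node G)] (σ : ArcSection G (Coatom G)) (hN : ∀ H : Coatom G, ¬ H.1.Normal) :
    Fintype.card (Incidence G) + 1 ≤ Fintype.card (Vertex G) + Fintype.card (Node G) := by
  obtain ⟨L₀⟩ := ‹Nonempty (Node G)›
  obtain ⟨H₀, -, -, h₀, -⟩ := L₀.2.1
  let v₀ : Vertex G := ⟨H₀, L₀, h₀⟩
  -- The extra column `none`, the indicator of `v₀`, accounts for the `+ 1`.
  let M : Matrix (Vertex G ⊕ Node G) (Option (Incidence G)) ℤ := fun i e =>
    match i, e with
    | .inl H, none => if v₀ = H then 1 else 0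
    | .inl H, some e => if e.1.1 = H then 1 else 0
    | .inr _, none => 0
    | .inr L, some e => if e.1.2 = L then 1 else 0
  have hinj : Function.Injective M.mulVecLin := by
    rw [← LinearMap.ker_eq_bot, LinearMap.ker_eq_bot']
    intro f hf
    have hV : ∀ H : Vertex G, (if v₀ = H then f none else 0) +
        ∑ e, (if e.1.1 = H then f (some e) else 0) = 0 := fun H => by
      have : ∑ e, M (.inl H) e * f e = 0 := congrFun hf (.inl H)
      rw [Fintype.sum_option] at this
      simpa [M] using this
    have hC : ∀ L : Node G, ∑ e, (if e.1.2 = L then f (some e) else 0) = 0 := fun L => by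
      have : ∑ e, M (.inr L) e * f e = 0 := congrFun hf (.inr L)
      rw [Fintype.sum_option] at this
      simpa [M] using this
    -- Each incidence contributes once on the node side and once on the vertex side; comparing the
    -- totals isolates `f none`.
    have hs : ∑ e, f (some e) = 0 := by
      have := Finset.sum_congr rfl (fun L (_ : L ∈ Finset.univ) => hC L)
      rw [Finset.sum_comm] at this
      simpa using this
    have hn : f none = 0 := by
      have := Finset.sum_congr rfl (fun H (_ : H ∈ Finset.univ) => hV H)
      rw [Finset.sum_add_distrib, Finset.sum_comm (f := fun H (e : Incidence G) => _)] at this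
      simpa [hs] using this
    have := eq_zero_of_incidence_sums σ hN (fun e => f (some e))
      (fun H => by simpa [hn] using hV H) hC
    funext e
    cases e with
    | none => exact hn
    | some e => exact congrFun this e
  simpa using card_le_of_injective ℤ M.mulVecLin hinj

end Acyclic

/-! ### Counting degrees when no node is normal. -/

section NonNormal

variable {L : Node G}

theorem Node.ne_coatom (L : Node G) (H : Coatom G) : L.1 ≠ H.1 := by
  intro e
  obtain ⟨H', hne, h⟩ := L.exists_ne H
  exact hne (Coatom.eq_of_le (e ▸ h)).symm

theorem Node.conj_eq_of_unique {H : Coatom G} (h : L.1 ≤ H.1)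
    (huniq : ∀ L' : Node G, L'.1 ≤ H.1 → L' = L) {g : G} (hg : g ∈ H.1) : L.conj g = L := by
  refine huniq _ fun x hx => ?_
  have := h (mem_mapSubgroup_conj.1 hx)
  rwa [H.1.mul_mem_cancel_right hg, H.1.mul_mem_cancel_left (H.1.inv_mem hg)] at this

/-- Conjugation by `H` permutes the nodes below `H`, so `H` normalizes its only one; maximality
gives equality. A leaf is thus recovered from its node. -/
theorem Node.normalizer_eq_of_unique (hL : ¬ L.1.Normal) {H : Coatom G} (h : L.1 ≤ H.1)
    (huniq : ∀ L' : Node G, L'.1 ≤ H.1 → L' = L) : Subgroup.normalizer (L.1 : Set G) = H.1 := by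
  have hle : H.1 ≤ Subgroup.normalizer (L.1 : Set G) := fun g hg => by
    rw [Subgroup.mem_normalizer_iff]
    intro x
    have e := congrArg Subtype.val (L.conj_eq_of_unique h huniq hg)
    conv_rhs => rw [← SetLike.mem_coe, SetLike.mem_coe, ← e]
    refine Iff.trans ?_ mem_mapSubgroup_conj.symm
    simp [mul_assoc]
  rcases hle.eq_or_lt with e | e
  · exact e.symm
  · exact absurd (Subgroup.normalizer_eq_top_iff.1 (H.2.2 _ e)) hL

/-- An element `g` of `H` outside `L` preserves `L` but moves any other `H'` above `L`, since `H ⊓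
H' ≤ L`. -/
theorem Node.exists_three (hN : ∀ H : Coatom G, ¬ H.1.Normal) {H : Coatom G} (h : L.1 ≤ H.1)
    (huniq : ∀ L' : Node G, L'.1 ≤ H.1 → L' = L) :
    ∃ H' H'' : Coatom G, H' ≠ H ∧ H'' ≠ H ∧ H' ≠ H'' ∧ L.1 ≤ H'.1 ∧ L.1 ≤ H''.1 := by
  obtain ⟨H', hne, h'⟩ := L.exists_ne H
  obtain ⟨g, hg, hgL⟩ := SetLike.exists_of_lt (lt_of_le_of_ne h (L.ne_coatom H))
  have hgH : g • H = H := smul_eq_of_mem hg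
  refine ⟨H', g • H', hne, ?_, ?_, h', ?_⟩
  · intro e
    rw [← hgH] at e
    exact hne (smul_left_cancel g e)
  · intro e
    exact hgL (L.inf_le hne h' h ⟨(smul_eq_iff hN).1 e.symm, hg⟩)
  · have e := congrArg Subtype.val (L.conj_eq_of_unique h huniq hg)
    rw [← e]
    exact (MulAut.conj g).mapSubgroup.monotone h'

open Classical in
theorem exists_normal_node [Fintype (Incidence G)] [Fintype (Vertex G)] [Fintype (Node G)]
    [Nonempty (Node G)] (σ : ArcSection G (Coatom G)) (hN : ∀ H : Coatom G, ¬ H.1.Normal) :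
    ∃ L : Node G, L.1.Normal := by
  by_contra! hL
  have hlt := card_incidence_add_one_le σ hN
  let d : Vertex G → ℕ := fun H => (Finset.univ.filter fun e : Incidence G => e.1.1 = H).card
  let m : Node G → ℕ := fun L => (Finset.univ.filter fun e : Incidence G => e.1.2 = L).card
  have hd : Fintype.card (Incidence G) = ∑ H, d H :=
    Finset.card_eq_sum_card_fiberwise fun _ _ => Finset.mem_univ _
  have hm : Fintype.card (Incidence G) = ∑ L, m L :=
    Finset.card_eq_sum_card_fiberwise fun _ _ => Finset.mem_univ _
  have hd1 : ∀ H, 1 ≤ d H := fun H => by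
    obtain ⟨L, hLH⟩ := H.2
    exact Finset.card_pos.2 ⟨⟨(H, L), hLH⟩, by simp⟩
  let leaf : Vertex G → Prop := fun H => d H = 1
  have huniq : ∀ H : Vertex G, leaf H → ∀ L : Node G, L.1 ≤ H.1.1 → ∀ L' : Node G,
      L'.1 ≤ H.1.1 → L' = L := by
    intro H hH L h L' h'
    have := Finset.card_le_one.1 (le_of_eq hH) ⟨(H, L'), h'⟩ (by simp) ⟨(H, L), h⟩ (by simp)
    exact congrArg (fun e : Incidence G => e.1.2) this
  have hm2 : ∀ L, 2 ≤ m L := by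
    intro L
    obtain ⟨H, H', hne, h, h'⟩ := L.2.1
    refine Finset.one_lt_card.2 ⟨⟨(⟨H, L, h⟩, L), h⟩, by simp, ⟨(⟨H', L, h'⟩, L), h'⟩, by simp, ?_⟩
    exact fun e => hne (congrArg (fun e : Incidence G => e.1.1.1) e)
  let pendant : Node G → Prop := fun L => ∃ H : Vertex G, leaf H ∧ L.1 ≤ H.1.1
  have hm3 : ∀ L, pendant L → 3 ≤ m L := by
    rintro L ⟨H, hH, h⟩
    obtain ⟨H', H'', h1, h2, h3, h', h''⟩ := L.exists_three hN h (huniq H hH L h)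
    refine Finset.two_lt_card.2 ⟨⟨(H, L), h⟩, by simp, ⟨(⟨H', L, h'⟩, L), h'⟩, by simp,
      ⟨(⟨H'', L, h''⟩, L), h''⟩, by simp, ?_, ?_, ?_⟩
    · exact fun e => h1 (congrArg (fun e : Incidence G => e.1.1.1) e).symm
    · exact fun e => h2 (congrArg (fun e : Incidence G => e.1.1.1) e).symm
    · exact fun e => h3 (congrArg (fun e : Incidence G => e.1.1.1) e)
  have hcard : (Finset.univ.filter leaf).card ≤ (Finset.univ.filter pendant).card := by
    choose l hl using fun H : Vertex G => H.2
    refine Finset.card_le_card_of_injOn l ?_ ?_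
    · intro H hH
      have hH : leaf H := by simpa using hH
      exact Finset.mem_coe.2 (Finset.mem_filter.2 ⟨Finset.mem_univ _, H, hH, hl H⟩)
    · intro H hH H' hH' e
      have hH : leaf H := by simpa using hH
      have hH' : leaf H' := by simpa using hH'
      refine Subtype.ext (Subtype.ext ?_)
      rw [← Node.normalizer_eq_of_unique (hL _) (hl H) (huniq H hH _ (hl H)),
        ← Node.normalizer_eq_of_unique (hL _) (hl H') (huniq H' hH' _ (hl H')), e]
  have hsum1 : 2 * Fintype.card (Vertex G) ≤
      Fintype.card (Incidence G) + (Finset.univ.filter leaf).card := by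
    rw [hd, Finset.card_filter, ← Finset.sum_add_distrib, mul_comm, ← smul_eq_mul,
      ← Finset.card_univ]
    refine Finset.card_nsmul_le_sum _ _ _ fun H _ => ?_
    have := hd1 H
    by_cases hH : leaf H
    · rw [if_pos hH]; omega
    · rw [if_neg hH]
      have : d H ≠ 1 := hH
      omega
  have hsum2 : 2 * Fintype.card (Node G) + (Finset.univ.filter pendant).card ≤
      Fintype.card (Incidence G) := by
    have : 2 * Fintype.card (Node G) = ∑ _L : Node G, 2 := by simp [mul_comm]
    rw [hm, this, Finset.card_filter, ← Finset.sum_add_distrib]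
    refine Finset.sum_le_sum fun L _ => ?_
    by_cases h : pendant L
    · rw [if_pos h]; exact hm3 L h
    · rw [if_neg h]; exact hm2 L
  -- The degree sums give `V + N ≤ E`, because leaves do not outnumber pendant nodes; the forest
  -- inequality `hlt` says `E + 1 ≤ V + N`.
  omega

end NonNormal

/-! ### Counting elements when a node is normal. -/

section Normal

theorem exists_mem_of_normal [Finite G] (hN : ∀ H : Coatom G, ¬ H.1.Normal) {L : Node G}
    (hL : L.1.Normal) (g : G) : ∃ H : Coatom G, L.1 ≤ H.1 ∧ g ∈ H.1 := by
  have hne : L.1 ⊔ Subgroup.zpowers g ≠ ⊤ := by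
    intro htop
    -- If `L` and `g` generated `G`, then `G ⧸ L` would be cyclic and any `H` above `L` normal.
    obtain ⟨H, -, -, h, -⟩ := L.2.1
    refine hN H (Subgroup.normalizer_eq_top_iff.1 (top_le_iff.1 ?_))
    rw [← htop, sup_le_iff, Subgroup.zpowers_le]
    refine ⟨h.trans Subgroup.le_normalizer, ?_⟩
    have key : ∀ k ∈ Subgroup.zpowers g, ∀ x ∈ H.1, k * x * k⁻¹ ∈ H.1 := by
      intro k hk x hx
      have hx' : x ∈ L.1 ⊔ Subgroup.zpowers g := htop ▸ Subgroup.mem_top x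
      obtain ⟨y, hy, z, hz, rfl⟩ := Subgroup.mem_sup_of_normal_left.1 hx'
      have hcomm : k * z = z * k := setLike_mul_comm hk hz
      have e : k * (y * z) * k⁻¹ = (k * y * k⁻¹) * y⁻¹ * (y * z) := by
        have : k * (y * z) * k⁻¹ = (k * y * k⁻¹) * (k * z * k⁻¹) := by group
        rw [this, hcomm]
        group
      rw [e]
      exact H.1.mul_mem (H.1.mul_mem (h (hL.conj_mem y hy k)) (H.1.inv_mem (h hy))) hx
    rw [Subgroup.mem_normalizer_iff]
    refine fun x => ⟨key g (Subgroup.mem_zpowers g) x, fun hx => ?_⟩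
    have := key g⁻¹ (Subgroup.inv_mem _ (Subgroup.mem_zpowers g)) _ hx
    simpa [mul_assoc] using this
  obtain ⟨H, hH, hle⟩ := (eq_top_or_exists_le_coatom _).resolve_left hne
  exact ⟨⟨H, hH⟩, le_sup_left.trans hle, hle (le_sup_right (a := L.1) (Subgroup.mem_zpowers g))⟩

-- The sets `H \ L`, for `H` above `L`, partition `G \ L`. The conjugates of one `H` cover at least
-- half of `G`, yet not all of `G \ L`; a second conjugacy class then exceeds the available
-- elements.
open Classical in
theorem not_normal_node [Finite G] (hN : ∀ H : Coatom G, ¬ H.1.Normal) (L : Node G) :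
    ¬ L.1.Normal := by
  intro hL
  have := Fintype.ofFinite G
  have := Fintype.ofFinite (Coatom G)
  let c : Coatom G → ℕ := fun H => (Finset.univ.filter fun g : G => g ∉ L.1 ∧ g ∈ H.1).card
  let M : Finset (Coatom G) := Finset.univ.filter fun H => L.1 ≤ H.1
  have hcardL : (Finset.univ.filter fun g : G => g ∈ L.1).card = Nat.card L.1 := by
    rw [Nat.card_eq_fintype_card, Fintype.card_subtype]
  have hLpos : 0 < Nat.card L.1 := Nat.card_pos
  have hM : ∑ H ∈ M, c H + Nat.card L.1 = Nat.card G := by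
    have h1 : ∑ H ∈ M, c H = ∑ g ∈ Finset.univ.filter (fun g : G => g ∉ L.1),
        (M.filter fun H => g ∈ H.1).card := by
      simp only [c, ← Finset.filter_filter]
      exact Finset.sum_card_bipartiteAbove_eq_sum_card_bipartiteBelow fun (H : Coatom G) g => g ∈ H.1
    have h2 : ∀ g ∈ Finset.univ.filter (fun g : G => g ∉ L.1),
        (M.filter fun H => g ∈ H.1).card = 1 := by
      intro g hg
      have hg : g ∉ L.1 := by simpa using hg
      obtain ⟨H, h, hgH⟩ := exists_mem_of_normal hN hL g
      rw [Finset.card_eq_one]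
      refine ⟨H, Finset.eq_singleton_iff_unique_mem.2 ⟨by simp [M, h, hgH], fun H' hH' => ?_⟩⟩
      obtain ⟨h', hgH'⟩ : L.1 ≤ H'.1 ∧ g ∈ H'.1 := by simpa [M] using hH'
      by_contra hne
      exact hg (L.inf_le hne h' h ⟨hgH', hgH⟩)
    rw [h1, Finset.sum_congr rfl h2, Finset.sum_const, smul_eq_mul, mul_one, ← hcardL, add_comm,
      Finset.card_filter_add_card_filter_not, Finset.card_univ, Nat.card_eq_fintype_card]
  have hc : ∀ H : Coatom G, L.1 ≤ H.1 → c H + Nat.card L.1 = Nat.card H.1 := by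
    intro H h
    have e : Nat.card H.1 = (Finset.univ.filter fun g : G => g ∈ H.1).card := by
      rw [Nat.card_eq_fintype_card, Fintype.card_subtype]
    rw [e, ← hcardL, ← Finset.card_union_of_disjoint]
    · congr 1
      ext g
      have := @h g
      simp
      tauto
    · rw [Finset.disjoint_left]
      simp
      tauto
  have hsub : ∀ {K : Subgroup G} {H : Subgroup G}, K < H → 2 * Nat.card K ≤ Nat.card H := by
    intro K H hlt
    obtain ⟨k, hk⟩ := Subgroup.card_dvd_of_le hlt.le
    have hne : Nat.card K ≠ Nat.card H := fun e =>
      hlt.ne (Subgroup.eq_of_le_of_card_ge hlt.le e.ge)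
    have : 0 < Nat.card H := Nat.card_pos
    rcases k with _ | _ | k
    · omega
    · omega
    · rw [hk]; nlinarith
  let O : Coatom G → Finset (Coatom G) := fun H => (MulAction.orbit G H).toFinset
  have hO : ∀ H : Coatom G, (O H).card * Nat.card H.1 = Nat.card G := by
    intro H
    have e : MulAction.stabilizer G H = H.1 := Subgroup.ext fun g => smul_eq_iff hN
    have := MulAction.card_orbit_mul_card_stabilizer_eq_card_group G H
    rw [← Nat.card_eq_fintype_card (α := MulAction.stabilizer G H), e] at this
    rw [Set.toFinset_card, this, Nat.card_eq_fintype_card]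
  have hsmul : ∀ (g : G) {H : Coatom G}, L.1 ≤ H.1 → L.1 ≤ (g • H).1 := by
    intro g H h x hx
    rw [coe_smul, mem_mapSubgroup_conj]
    have := h (hL.conj_mem x hx g⁻¹)
    simpa using this
  have hOM : ∀ H ∈ M, O H ⊆ M := by
    intro H hH H' hH'
    obtain ⟨g, rfl⟩ : ∃ g : G, g • H = H' := by simpa [O, MulAction.mem_orbit_iff] using hH'
    have h : L.1 ≤ H.1 := by simpa [M] using hH
    simpa [M] using hsmul g h
  have hcardsmul : ∀ (g : G) (H : Coatom G), Nat.card (g • H).1 = Nat.card H.1 := fun g H =>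
    (Nat.card_congr ((MulAut.conj g).subgroupMap H.1).toEquiv).symm
  have hsum : ∀ H ∈ M, ∑ H' ∈ O H, c H' + (O H).card * Nat.card L.1 = Nat.card G := by
    intro H hH
    rw [← hO H, ← smul_eq_mul, ← smul_eq_mul, ← Finset.sum_const, ← Finset.sum_const,
      ← Finset.sum_add_distrib]
    refine Finset.sum_congr rfl fun H' hH' => ?_
    have h' : L.1 ≤ H'.1 := by simpa [M] using hOM H hH hH'
    obtain ⟨g, rfl⟩ : ∃ g : G, g • H = H' := by simpa [O, MulAction.mem_orbit_iff] using hH'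
    rw [hc _ h', hcardsmul]
  have hhalf : ∀ H ∈ M, 2 * ((O H).card * Nat.card L.1) ≤ Nat.card G := by
    intro H hH
    have h : L.1 ≤ H.1 := by simpa [M] using hH
    rw [← hO H]
    nlinarith [hsub (lt_of_le_of_ne h (L.ne_coatom H))]
  obtain ⟨H, -, -, h, -⟩ := L.2.1
  have hH : H ∈ M := by simpa [M] using h
  have hO2 : 2 ≤ (O H).card := by
    have h1 := hO H
    have h2 := hsub (lt_top_iff_ne_top.2 H.2.1)
    rw [Subgroup.card_top, ← h1] at h2
    exact Nat.le_of_mul_le_mul_right h2 Nat.card_pos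
  -- If one orbit were all of `M`, then `hsum` and `hM` would force `(O H).card = 1`.
  obtain ⟨H', hH', hH'O⟩ : ∃ H' ∈ M, H' ∉ O H := by
    by_contra! hall
    have e : O H = M := Finset.Subset.antisymm (hOM H hH) hall
    have h1 := hsum H hH
    rw [e] at h1 hO2
    nlinarith
  have hdisj : Disjoint (O H) (O H') := by
    rw [Finset.disjoint_left]
    intro K hK hK'
    have hK : K ∈ MulAction.orbit G H := by simpa [O] using hK
    have hK' : K ∈ MulAction.orbit G H' := by simpa [O] using hK'
    apply hH'O
    rw [Set.mem_toFinset, ← MulAction.orbit_eq_iff.2 hK, MulAction.orbit_eq_iff.2 hK']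
    exact MulAction.mem_orbit_self H'
  have hle : ∑ K ∈ O H, c K + ∑ K ∈ O H', c K ≤ ∑ K ∈ M, c K := by
    rw [← Finset.sum_union hdisj]
    exact Finset.sum_le_sum_of_subset (Finset.union_subset (hOM H hH) (hOM H' hH'))
  have h1 := hsum H hH
  have h2 := hsum H' hH'
  have h3 := hhalf H hH
  have h4 := hhalf H' hH'
  omega

end Normal

end Coatom

/-! ### Conclusion. -/

theorem ArcSection.false_of_fixed {G X : Type*} [Group G] [Finite G] [Nontrivial G]
    [MulAction G X] (σ : ArcSection G X)
    (hfix : ∀ H : Subgroup G, H ≠ ⊤ → ∃ x : X, H ≤ MulAction.stabilizer G x)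
    (hstab : ∀ x : X, MulAction.stabilizer G x ≠ ⊤) : False := by
  obtain ⟨hN, ⟨τ⟩⟩ := Coatom.nonempty_arcSection σ hfix hstab
  have := Coatom.nonempty_node hN
  have := Fintype.ofFinite (Coatom.Vertex G)
  have := Fintype.ofFinite (Coatom.Node G)
  have := Fintype.ofFinite (Coatom.Incidence G)
  obtain ⟨L, hL⟩ := Coatom.exists_normal_node τ hN
  exact Coatom.not_normal_node hN L hL

theorem theorem1p5 {Γ : Type u} [Group Γ] [Finite Γ] (F : SubgroupFamily Γ)
    (hF : ∀ H ∈ F.carrier, H ≠ ⊤) :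
    2 ≤ bredonCohomologicalDimension F := by
  refine (projectiveDimension_ge_iff (constIntModule (OrbitCategory F)) 2).2 fun h => ?_
  obtain ⟨σ⟩ := OrbitCategory.nonempty_arcSection h
  -- By minimality every proper subgroup of `K` is in the family and fixes a point, while `K`, lying
  -- outside, fixes none.
  obtain ⟨K, -, hK⟩ := (Set.toFinite {K : Subgroup Γ | K ∉ F.carrier}).exists_le_minimal
    (a := ⊤) fun htop => hF ⊤ htop rfl
  have hsub : ∀ H : Subgroup K, H ≠ ⊤ → H.map K.subtype ∈ F.carrier := by
    intro H hH
    by_contra hmem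
    have hle := hK.2 hmem (Subgroup.map_subtype_le H)
    refine hH ((Subgroup.eq_top_iff' H).2 fun x => ?_)
    obtain ⟨y, hy, hxy⟩ := hle x.2
    rwa [← Subtype.ext hxy]
  have : Nontrivial K := by
    rw [Subgroup.nontrivial_iff_ne_bot]
    rintro rfl
    obtain ⟨H, hH⟩ := F.nonempty
    exact hK.1 (F.mem_of_le H hH ⊥ bot_le)
  refine (σ.restrict K).false_of_fixed (fun H hH => ?_) fun x hx => ?_
  · obtain ⟨x, hx⟩ := OrbitCategory.exists_fixed (hsub H hH)
    exact ⟨x, fun g hg => hx g ⟨g, hg, rfl⟩⟩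
  · refine hK.1 (F.mem_of_le _ (OrbitCategory.stabilizer_mem x) K fun g hg => ?_)
    exact hx.ge (Subgroup.mem_top (⟨g, hg⟩ : K))
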